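/- An iterative derivation (ID) on a commutative ring $R$ is a ring homomorphism $\theta:R\to R[[T]]$, $\theta(r)=\sum_{k\ge 0}\theta^{(k)}(r)T^k$, with $\theta^{(0)}=\mathrm{id}_R$ and $\theta^{(i)}\circ\theta^{(j)}=\binom{i+j}{i}\theta^{(i+j)}$ for all $i,j\ge 0$; its ring of constants is $C_R=\{r\in R: \theta(r)=r\}$, an ideal $I$ is an ID-ideal if $\theta(I)\subseteq I[[T]]$, and $R\neq 0$ is ID-simple if $0$ and $R$ are its only ID-ideals. Let $(F,\theta)$ be a field of characteristic $p>0$ with an iterative derivation such that $\theta^{(1)}\ne 0$ and such that its field of constants $C=C_F$ is perfect. Let $E/F$ be a finite Galois extension with group $G=\mathrm{Gal}(E/F)$ which is geometric over $C$, i.e. $C$ is algebraically closed in $E$. Then $\theta$ extends to exactly one iterative derivation $\theta_E$ on $E$, and with $E$ equipped with $\theta_E$ the following holds. (1) $E/F$ is a Picard-Vessiot extension: $E$ is, as an ID-field over $F$, the quotient field of a Picard-Vessiot ring over $F$. Here an ID-ring $(R,\theta_R)$ extending $(F,\theta)$ is a Picard-Vessiot ring over $F$ if, for some $n$ and some $A=\sum_k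 A_kT^k\in \mathrm{GL}_n(F[[T]])$ with $A_0=1$ and $\binom{k+l}{l}A_{k+l}=\sum_{i+j=l}\theta^{(i)}(A_k)A_j$ for all $k,l\ge 0$: $R$ is ID-simple, $C_R=C$, and there is $Y\in\mathrm{GL}_n(R)$ with $\theta_R(Y)=AY$ such that $R$ is generated as an $F$-algebra by the entries of $Y$ and $\det(Y)^{-1}$. (2) The Galois group scheme of $E/F$ is the constant group scheme of $G$. That is, for each Picard-Vessiot ring $R$ over $F$ with quotient field $E$ (as ID-fields over $F$), the group functor $D\mapsto \mathrm{Aut}^{ID}(R\otimes_C D/F\otimes_C D)$ on commutative $C$-algebras $D$ (with trivial iterative derivation), of ring automorphisms of $R\otimes_C D$ that fix $F\otimes_C D$ and commute with the iterative derivation $\theta^{(k)}(r\otimes d)=\theta^{(k)}(r)\otimes d$, is isomorphic to the functor of points of the affine group scheme $\mathrm{Spec}(C[G])$, where $C[G]$ is the ring of functions $G\to C$ with the Hopf algebra structure $(\Delta f)(g,h)=f(gh)$, $\varepsilon(f)=f(1)$, $(Sf)(g)=f(g^{-1})$. The isomorphism can be chosen so that the $D$-point of $\mathrm{Spec}(C[G])$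 given by evaluation at $\sigma\in G$ corresponds to the automorphism $r\otimes d\mapsto\sigma(r)\otimes d$. -/

import Mathlib

open scoped TensorProduct PowerSeries

universe u v w x

/-! ### Iterative derivations -/

/-- An iterative derivation on a commutative ring `R`: a ring homomorphism
`θ : R → R[[T]]`, `θ(r) = ∑ θ⁽ⁱ⁾(r) Tⁱ`, with `θ⁽⁰⁾ = id` and
`θ⁽ⁱ⁾ ∘ θ⁽ʲ⁾ = binom(i+j, i) θ⁽ⁱ⁺ʲ⁾`. -/
@[ext]
structure IterativeDerivation (R : Type u) [CommRing R] where
  toRingHom : R →+* R⟦X⟧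
  coeff_zero : ∀ r : R, PowerSeries.coeff 0 (toRingHom r) = r
  coeff_coeff : ∀ (i j : ℕ) (r : R),
    PowerSeries.coeff i (toRingHom (PowerSeries.coeff j (toRingHom r))) =
      (i + j).choose i • PowerSeries.coeff (i + j) (toRingHom r)

namespace IterativeDerivation

section Ring

variable {R : Type u} [CommRing R]

/-- The components `θ⁽ᵏ⁾ : R → R`. -/
noncomputable def der (θ : IterativeDerivation R) (k : ℕ) : R →+ R :=
  (PowerSeries.coeff (R := R) k).toAddMonoidHom.comp θ.toRingHom.toAddMonoidHom

/-- The ring of constants `{r | θ(r) = r}`. -/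
noncomputable def constants (θ : IterativeDerivation R) : Subring R :=
  RingHom.eqLocus θ.toRingHom (PowerSeries.C (R := R))

/-- An ideal `I` is an ID-ideal if `θ(I) ⊆ I[[T]]`. -/
def IsIDIdeal (θ : IterativeDerivation R) (I : Ideal R) : Prop :=
  ∀ r ∈ I, ∀ k : ℕ, θ.der k r ∈ I

/-- `R` is ID-simple if it is nonzero and `0` and `R` are its only ID-ideals. -/
def IsIDSimple (θ : IterativeDerivation R) : Prop :=
  Nontrivial R ∧ ∀ I : Ideal R, θ.IsIDIdeal I → I = ⊥ ∨ I = ⊤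

/-- `θ` is non-degenerate if `θ⁽¹⁾ ≠ 0`. -/
def IsNondegenerate (θ : IterativeDerivation R) : Prop :=
  θ.der 1 ≠ 0

/-- `θ'` on the `R`-algebra `S` extends `θ` on `R`, i.e. `R → S` is a homomorphism of
ID-rings. -/
def Extends {S : Type v} [CommRing S] [Algebra R S] (θ' : IterativeDerivation S)
    (θ : IterativeDerivation R) : Prop :=
  ∀ r : R, θ'.toRingHom (algebraMap R S r) =
    PowerSeries.map (algebraMap R S) (θ.toRingHom r)

end Ring

/-- The field of constants of an ID-field. -/
noncomputable def constantField {F : Type u} [Field F] (θ : IterativeDerivation F) : Subfield F :=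
  RingHom.eqLocusField θ.toRingHom (PowerSeries.C (R := F))

theorem Extends.algebraMap_constantField {F : Type u} {R : Type v} [Field F] [CommRing R]
    [Algebra F R] {θ : IterativeDerivation F} {θR : IterativeDerivation R}
    (h : θR.Extends θ) (c : θ.constantField) :
    θR.toRingHom (algebraMap θ.constantField R c) =
      PowerSeries.C (algebraMap θ.constantField R c) := by
  have hc : θ.toRingHom (c : F) = PowerSeries.C (c : F) := c.2
  have h2 := h (c : F)
  rw [hc, PowerSeries.map_C] at h2
  exact h2

/-! ### Extension of scalars by a ring with trivial iterative derivation -/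

section TensorTrivial

variable {K : Type u} {R : Type v} [CommRing K] [CommRing R] [Algebra K R]
  (θ : IterativeDerivation R)
  (hθ : ∀ c : K, θ.toRingHom (algebraMap K R c) = PowerSeries.C (algebraMap K R c))
  (D : Type w) [CommRing D] [Algebra K D]

/-- The ring homomorphism `R ⊗ D → (R ⊗ D)[[T]]`, `r ⊗ d ↦ ∑ (θ⁽ᵏ⁾(r) ⊗ d) Tᵏ`. -/
noncomputable def tensorTrivialHom : R ⊗[K] D →ₐ[K] (R ⊗[K] D)⟦X⟧ :=
  Algebra.TensorProduct.lift
    ({ toRingHom := (PowerSeries.map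
          (algebraMap R (R ⊗[K] D))).comp θ.toRingHom
       commutes' := fun c => by
        change PowerSeries.map (algebraMap R (R ⊗[K] D))
          (θ.toRingHom (algebraMap K R c)) = _
        rw [hθ c, PowerSeries.map_C, ← IsScalarTower.algebraMap_apply,
          IsScalarTower.algebraMap_apply K (R ⊗[K] D) (R ⊗[K] D)⟦X⟧]
        rfl } : R →ₐ[K] (R ⊗[K] D)⟦X⟧)
    ((IsScalarTower.toAlgHom K (R ⊗[K] D) (R ⊗[K] D)⟦X⟧).comp
      (Algebra.TensorProduct.includeRight : D →ₐ[K] R ⊗[K] D))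
    (fun _ _ => Commute.all _ _)

theorem coeff_tensorTrivialHom_tmul (k : ℕ) (r : R) (d : D) :
    PowerSeries.coeff k (tensorTrivialHom θ hθ D (r ⊗ₜ d)) = (θ.der k r) ⊗ₜ[K] d := by
  rw [tensorTrivialHom, Algebra.TensorProduct.lift_tmul]
  change PowerSeries.coeff k (PowerSeries.map (algebraMap R (R ⊗[K] D)) (θ.toRingHom r) *
    PowerSeries.C ((1 : R) ⊗ₜ[K] d)) = _
  rw [PowerSeries.coeff_mul_C, PowerSeries.coeff_map]
  simp [der]

/-- The iterative derivation `θ⁽ᵏ⁾(r ⊗ d) = θ⁽ᵏ⁾(r) ⊗ d` on `R ⊗ D`, where `D` carries the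
trivial iterative derivation and the base ring `K` consists of constants. -/
noncomputable def tensorTrivial : IterativeDerivation (R ⊗[K] D) where
  toRingHom := (tensorTrivialHom θ hθ D).toRingHom
  coeff_zero := fun x => by
    change PowerSeries.coeff 0 (tensorTrivialHom θ hθ D x) = x
    induction x with
    | zero => simp
    | add x y hx hy => rw [map_add, map_add, hx, hy]
    | tmul r d =>
      rw [coeff_tensorTrivialHom_tmul]
      exact congrArg (· ⊗ₜ[K] d) (θ.coeff_zero r)
  coeff_coeff := fun i j x => by
    change PowerSeries.coeff i (tensorTrivialHom θ hθ D
      (PowerSeries.coeff j (tensorTrivialHom θ hθ D x))) =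
        _ • PowerSeries.coeff (i + j) (tensorTrivialHom θ hθ D x)
    induction x with
    | zero => simp
    | add x y hx hy => simp only [map_add, hx, hy, smul_add]
    | tmul r d =>
      simp only [coeff_tensorTrivialHom_tmul]
      rw [TensorProduct.smul_tmul']
      exact congrArg (· ⊗ₜ[K] d) (θ.coeff_coeff i j r)

end TensorTrivial

/-! ### Iterative differential equations and Picard-Vessiot extensions -/

/-- An iterative differential equation `θ(y) = A y` of size `n` over `(F, θ)`, given by
`A = ∑ A_k Tᵏ ∈ GL_n(F[[T]])` with `A_0 = 1` and
`binom(k+l, l) A_{k+l} = ∑_{i+j=l} θ⁽ⁱ⁾(A_k) A_j`. -/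
structure IDE {F : Type u} [Field F] (θ : IterativeDerivation F) (n : ℕ) where
  A : GL (Fin n) F⟦X⟧
  coeff_zero : A.val.map (PowerSeries.coeff 0) = 1
  compat : ∀ k l : ℕ,
    (k + l).choose l • A.val.map (PowerSeries.coeff (k + l)) =
      ∑ ij ∈ Finset.HasAntidiagonal.antidiagonal l,
        ((A.val.map (PowerSeries.coeff k)).map (θ.der ij.1)) *
          A.val.map (PowerSeries.coeff ij.2)

section PicardVessiot

variable {F : Type u} [Field F] (θ : IterativeDerivation F)

/-- `Y ∈ GL_n(R)` is a fundamental solution matrix: `θ(Y) = A Y` in `R[[T]]`. -/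
def IDE.IsFundamentalSolution {θ : IterativeDerivation F} {n : ℕ} (a : θ.IDE n)
    {R : Type v} [CommRing R] [Algebra F R] (θR : IterativeDerivation R)
    (Y : GL (Fin n) R) : Prop :=
  Y.val.map θR.toRingHom =
    a.A.val.map (PowerSeries.map (algebraMap F R)) * Y.val.map (PowerSeries.C (R := R))

/-- The ID-ring `(R, θR)` over `(F, θ)` is a Picard-Vessiot ring for the given equation. -/
structure IDE.IsPVRing {θ : IterativeDerivation F} {n : ℕ} (a : θ.IDE n)
    {R : Type v} [CommRing R] [Algebra F R] (θR : IterativeDerivation R) : Prop where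
  isExtension : θR.Extends θ
  isIDSimple : θR.IsIDSimple
  exists_solution : ∃ Y : GL (Fin n) R, a.IsFundamentalSolution θR Y ∧
    Algebra.adjoin F ({r : R | ∃ i j, r = Y.val i j} ∪ {(Matrix.det Y⁻¹.val : R)}) = ⊤
  constants_eq : θR.constants = θ.constants.map (algebraMap F R)

/-- The ID-field `(E, θE)` has `(R, θR)` as a Picard-Vessiot ring: `R` is a Picard-Vessiot ring
for some iterative differential equation over `F`, and `E = Quot(R)` as ID-rings over `F`. -/
structure HasPVRing {E : Type v} [Field E] [Algebra F E] (θE : IterativeDerivation E)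
    {R : Type v} [CommRing R] [Algebra F R] [Algebra R E] [IsScalarTower F R E]
    (θR : IterativeDerivation R) : Prop where
  isPVRing : ∃ (n : ℕ) (a : θ.IDE n), a.IsPVRing θR
  isFractionRing : IsFractionRing R E
  extends_ring : θE.Extends θR

/-- `(E, θE)` is a Picard-Vessiot extension of `(F, θ)`: it is the quotient field of a
Picard-Vessiot ring for some iterative differential equation over `F`. -/
def IsPVExtension {E : Type v} [Field E] [Algebra F E] (θE : IterativeDerivation E) : Prop :=
  ∃ (R : Type v) (_ : CommRing R) (_ : Algebra F R) (_ : Algebra R E)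
    (_ : IsScalarTower F R E) (θR : IterativeDerivation R), HasPVRing θ θE θR

end PicardVessiot

/-! ### The Galois group scheme -/

section Galois

variable {F : Type u} [Field F] {θ : IterativeDerivation F}
  {R : Type v} [CommRing R] [Algebra F R] {θR : IterativeDerivation R}

/-- The group `Aut^ID(R ⊗_C D / F ⊗_C D)` of automorphisms of the ring `R ⊗_C D` that fix the
image of `F ⊗_C D` (in particular they are `C`-linear) and commute with the iterative
derivation, where `C` is the field of constants of `F` and `D` carries the trivial iterative
derivation. -/
noncomputable def idAut (h : θR.Extends θ) (D : Type w) [CommRing D]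
    [Algebra θ.constantField D] :
    Subgroup ((R ⊗[θ.constantField] D) ≃ₐ[θ.constantField] (R ⊗[θ.constantField] D)) where
  carrier := {α |
    (∀ x : F ⊗[θ.constantField] D,
      α (Algebra.TensorProduct.map
          (IsScalarTower.toAlgHom θ.constantField F R) (AlgHom.id θ.constantField D) x) =
        Algebra.TensorProduct.map
          (IsScalarTower.toAlgHom θ.constantField F R) (AlgHom.id θ.constantField D) x) ∧
    ∀ (k : ℕ) (x : R ⊗[θ.constantField] D),
      (θR.tensorTrivial h.algebraMap_constantField D).der k (α x) =
        α ((θR.tensorTrivial h.algebraMap_constantField D).der k x)}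
  mul_mem' := fun {α β} hα hβ => by
    refine ⟨fun x => ?_, fun k x => ?_⟩
    · rw [AlgEquiv.mul_apply, hβ.1, hα.1]
    · rw [AlgEquiv.mul_apply, AlgEquiv.mul_apply, hα.2, hβ.2]
  one_mem' := ⟨fun _ => rfl, fun _ _ => rfl⟩
  inv_mem' := fun {α} hα => by
    refine ⟨fun x => α.injective ?_, fun k x => α.injective ?_⟩
    · rw [hα.1]
      exact α.apply_symm_apply _
    · rw [← hα.2]
      change _ = α (α.symm _)
      rw [α.apply_symm_apply]
      exact congrArg _ (α.apply_symm_apply x)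

/-- An isomorphism of group functors on commutative `C`-algebras `D` (in a given universe)
between the functor of points `D ↦ Hom_{C-alg}(H, D)` of the affine group scheme `Spec H`
(with its convolution product) and `D ↦ Aut^ID(R ⊗_C D / F ⊗_C D)`; in other words, an
identification of `Spec H` with the Galois group scheme of `R` over `F`.
In `natural`, the automorphism on the left is the base change along `f : D → D'` of the one
on the right: a `D'`-linear automorphism of `R ⊗_C D'` is determined by its values on the image
of `R ⊗_C D`. -/
structure GaloisGroupSchemeIso (h : θR.Extends θ) (H : Type x) [CommRing H]
    [HopfAlgebra θ.constantField H] where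
  equiv : ∀ (D : Type w) [CommRing D] [Algebra θ.constantField D],
    WithConv (H →ₐ[θ.constantField] D) ≃* idAut h D
  natural : ∀ (D D' : Type w) [CommRing D] [CommRing D'] [Algebra θ.constantField D]
    [Algebra θ.constantField D'] (f : D →ₐ[θ.constantField] D')
    (φ : H →ₐ[θ.constantField] D) (x : R ⊗[θ.constantField] D),
    (equiv D' (WithConv.toConv (f.comp φ))).val
        (Algebra.TensorProduct.map (AlgHom.id θ.constantField R) f x) =
      Algebra.TensorProduct.map (AlgHom.id θ.constantField R) f
        ((equiv D (WithConv.toConv φ)).val x)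

end Galois

end IterativeDerivation

/-- An extension `E` of the field `C` is geometric over `C` if `C` is
algebraically closed in `E`. -/
def IsGeometricOver (C : Type u) (E : Type v) [Field C] [Field E] [Algebra C E] : Prop :=
  ∀ x : E, IsAlgebraic C x → x ∈ Set.range (algebraMap C E)

/-! ### Constant group schemes -/

/-- The coordinate ring `C[G]` of the constant group scheme over `C` of a finite group `G`:
the ring of functions `G → C`. It carries the Hopf algebra structure given by
`(Δ f)(g, h) = f (g h)`, `ε(f) = f(1)` and `(S f)(g) = f(g⁻¹)`. -/
def ConstGroupRing (C : Type u) (G : Type v) : Type (max u v) := G → C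

namespace ConstGroupRing

section

variable (C : Type u) (G : Type v) [CommRing C]

noncomputable instance : CommRing (ConstGroupRing C G) := inferInstanceAs (CommRing (G → C))

noncomputable instance : Algebra C (ConstGroupRing C G) := inferInstanceAs (Algebra C (G → C))

variable {G} in
/-- Evaluation at `g`, the `C`-rational point of the constant group scheme given by `g`. -/
def eval (g : G) : ConstGroupRing C G →ₐ[C] C := Pi.evalAlgHom C (fun _ : G => C) g

theorem eval_smul (g : G) (c : C) (f : ConstGroupRing C G) :
    (c • f : ConstGroupRing C G) g = c * f g := rfl

theorem hom_ext {f f' : ConstGroupRing C G} (h : ∀ g, eval C g f = eval C g f') : f = f' :=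
  funext h

end

section

variable (C : Type u) {G : Type v} [CommRing C]

open Classical in
/-- The indicator function of `{g}`. -/
noncomputable def delta (g : G) : ConstGroupRing C G := fun x => if x = g then 1 else 0

open Classical in
theorem eval_delta (g x : G) : eval C x (delta C g) = if x = g then 1 else 0 := rfl

theorem eq_sum [Fintype G] (f : ConstGroupRing C G) : f = ∑ g : G, eval C g f • delta C g := by
  classical
  apply hom_ext
  intro x
  simp [map_sum, eval_delta]

theorem delta_mul_delta [DecidableEq G] (g h : G) :
    delta C g * delta C h = if g = h then delta C g else 0 := by
  apply hom_ext
  intro x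
  rw [map_mul, eval_delta, eval_delta]
  split_ifs <;> simp_all [eval_delta]

theorem sum_delta [Fintype G] : ∑ g : G, delta C g = 1 := by
  have := eq_sum C (1 : ConstGroupRing C G)
  simpa using this.symm

theorem algHom_eq_of_delta [Fintype G] {M : Type*} [AddCommMonoid M] [Module C M]
    {φ ψ : ConstGroupRing C G →ₗ[C] M} (h : ∀ g, φ (delta C g) = ψ (delta C g)) : φ = ψ := by
  ext f
  rw [eq_sum C f, map_sum, map_sum]
  exact Finset.sum_congr rfl fun g _ => by rw [map_smul, map_smul, h]

end

section Hopf

variable (C : Type u) (G : Type v) [CommRing C] [Group G] [Fintype G]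

/-- Comultiplication, `(Δ f)(g, h) = f (g h)`:
`Δ f = ∑_{g, h} f(g h) δ_g ⊗ δ_h`. -/
noncomputable def comulLin :
    ConstGroupRing C G →ₗ[C] ConstGroupRing C G ⊗[C] ConstGroupRing C G :=
  ∑ g : G, ∑ h : G,
    (eval C (g * h)).toLinearMap.smulRight (delta C g ⊗ₜ[C] delta C h)

theorem comulLin_apply (f : ConstGroupRing C G) :
    comulLin C G f = ∑ g : G, ∑ h : G, eval C (g * h) f • (delta C g ⊗ₜ[C] delta C h) := by
  simp [comulLin]

theorem comulLin_delta (k : G) :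
    comulLin C G (delta C k) = ∑ g : G, delta C g ⊗ₜ[C] delta C (g⁻¹ * k) := by
  classical
  rw [comulLin_apply]
  refine Finset.sum_congr rfl fun g _ => ?_
  rw [Finset.sum_eq_single (g⁻¹ * k)]
  · simp [eval_delta]
  · intro h _ hne
    rw [eval_delta, if_neg, zero_smul]
    rintro rfl
    simp at hne
  · simp

/-- Comultiplication as an algebra homomorphism. -/
noncomputable def comulHom :
    ConstGroupRing C G →ₐ[C] ConstGroupRing C G ⊗[C] ConstGroupRing C G :=
  AlgHom.ofLinearMap (comulLin C G)
    (by
      rw [comulLin_apply]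
      simp only [map_one, one_smul]
      simp_rw [← TensorProduct.tmul_sum, sum_delta, ← TensorProduct.sum_tmul, sum_delta]
      rfl)
    (by
      classical
      intro f f'
      simp only [comulLin_apply, Finset.sum_mul_sum, map_mul]
      refine Finset.sum_congr rfl fun g _ => Eq.symm ?_
      rw [Finset.sum_eq_single g]
      · refine Finset.sum_congr rfl fun h _ => ?_
        rw [Finset.sum_eq_single h]
        · rw [smul_mul_smul_comm, Algebra.TensorProduct.tmul_mul_tmul, delta_mul_delta,
            delta_mul_delta, if_pos rfl, if_pos rfl]
        · intro h' _ hne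
          rw [smul_mul_smul_comm, Algebra.TensorProduct.tmul_mul_tmul,
            delta_mul_delta C h, if_neg hne.symm, TensorProduct.tmul_zero, smul_zero]
        · simp
      · intro g' _ hne
        refine Finset.sum_eq_zero fun h _ => Finset.sum_eq_zero fun h' _ => ?_
        rw [smul_mul_smul_comm, Algebra.TensorProduct.tmul_mul_tmul,
          delta_mul_delta C g, if_neg hne.symm, TensorProduct.zero_tmul, smul_zero]
      · simp)

noncomputable instance : Bialgebra C (ConstGroupRing C G) :=
  Bialgebra.ofAlgHom (comulHom C G) (eval C 1)
    (by
      apply AlgHom.toLinearMap_injective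
      apply algHom_eq_of_delta
      intro k
      change Algebra.TensorProduct.assoc C C C _ _ _
        (Algebra.TensorProduct.map _ _ (comulLin C G (delta C k))) =
          Algebra.TensorProduct.map _ _ (comulLin C G (delta C k))
      rw [comulLin_delta]
      simp only [map_sum, Algebra.TensorProduct.map_tmul, AlgHom.id_apply]
      have hc : ∀ g, comulHom C G (delta C g) = ∑ h : G, delta C h ⊗ₜ[C] delta C (h⁻¹ * g) :=
        fun g => comulLin_delta C G g
      simp only [hc, TensorProduct.sum_tmul, TensorProduct.tmul_sum, map_sum,
        Algebra.TensorProduct.assoc_tmul]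
      rw [Finset.sum_comm]
      refine Finset.sum_congr rfl fun h _ => ?_
      refine Fintype.sum_equiv (Equiv.mulLeft h⁻¹) _ _ fun g => ?_
      simp [mul_assoc])
    (by
      classical
      apply AlgHom.toLinearMap_injective
      apply algHom_eq_of_delta
      intro k
      change Algebra.TensorProduct.map _ _ (comulLin C G (delta C k)) =
        (1 : C) ⊗ₜ[C] delta C k
      rw [comulLin_delta]
      simp only [map_sum, Algebra.TensorProduct.map_tmul, AlgHom.id_apply, eval_delta]
      rw [Finset.sum_eq_single 1]
      · simp
      · intro g _ hne
        rw [if_neg hne.symm, TensorProduct.zero_tmul]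
      · simp)
    (by
      classical
      apply AlgHom.toLinearMap_injective
      apply algHom_eq_of_delta
      intro k
      change Algebra.TensorProduct.map _ _ (comulLin C G (delta C k)) =
        delta C k ⊗ₜ[C] (1 : C)
      rw [comulLin_delta]
      simp only [map_sum, Algebra.TensorProduct.map_tmul, AlgHom.id_apply, eval_delta]
      rw [Finset.sum_eq_single k]
      · simp
      · intro g _ hne
        rw [if_neg, TensorProduct.tmul_zero]
        intro h
        exact hne (inv_mul_eq_one.mp h.symm)
      · simp)

end Hopf

section Antipode

variable (C : Type u) (G : Type v) [CommRing C] [Group G]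

/-- The antipode `(S f)(g) = f(g⁻¹)`. -/
noncomputable def antipodeLin : ConstGroupRing C G →ₗ[C] ConstGroupRing C G where
  toFun f := fun g => eval C g⁻¹ f
  map_add' _ _ := rfl
  map_smul' _ _ := rfl

theorem antipodeLin_delta (g : G) : antipodeLin C G (delta C g) = delta C g⁻¹ := by
  classical
  apply hom_ext
  intro x
  change eval C x⁻¹ (delta C g) = _
  rw [eval_delta, eval_delta]
  simp [inv_eq_iff_eq_inv]

variable [Fintype G]

noncomputable instance : HopfAlgebra C (ConstGroupRing C G) where
  antipode := antipodeLin C G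
  mul_antipode_rTensor_comul := by
    classical
    apply algHom_eq_of_delta
    intro k
    change LinearMap.mul' C _ ((antipodeLin C G).rTensor _ (comulLin C G (delta C k))) =
      algebraMap C _ (eval C 1 (delta C k))
    rw [comulLin_delta]
    simp only [map_sum, LinearMap.rTensor_tmul, LinearMap.mul'_apply, antipodeLin_delta,
      delta_mul_delta, eval_delta]
    by_cases hk : 1 = k
    · subst hk
      simp only [mul_one, if_true, map_one]
      rw [← sum_delta C (G := G)]
      exact Fintype.sum_equiv (Equiv.inv G) _ _ fun g => rfl
    · rw [if_neg hk, map_zero]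
      refine Finset.sum_eq_zero fun g _ => if_neg fun h => hk ?_
      simpa [eq_comm] using h
  mul_antipode_lTensor_comul := by
    classical
    apply algHom_eq_of_delta
    intro k
    change LinearMap.mul' C _ ((antipodeLin C G).lTensor _ (comulLin C G (delta C k))) =
      algebraMap C _ (eval C 1 (delta C k))
    rw [comulLin_delta]
    simp only [map_sum, LinearMap.lTensor_tmul, LinearMap.mul'_apply, antipodeLin_delta,
      delta_mul_delta, eval_delta]
    by_cases hk : 1 = k
    · subst hk
      simp only [mul_one, inv_inv, if_true, map_one]
      exact sum_delta C
    · rw [if_neg hk, map_zero]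
      refine Finset.sum_eq_zero fun g _ => if_neg fun h => hk ?_
      rw [mul_inv_rev, inv_inv] at h
      have := congrArg (k⁻¹ * ·) h
      simp at this
      exact this.symm

end Antipode

end ConstGroupRing

/-!
Two facts about a finite Galois extension `E / F` with group `G` carry the proof.

*Unique lifting.* An iterative derivation on `E` is a lift of the identity of `E` along
`E[[T]] → E`. Since `E / F` is formally étale and `E[[T]]` is `T`-adically complete, the
homomorphism `F → E[[T]]` given by `θ` has such a lift to `E`. Lifts are unique by Hensel's lemma
(`ringHom_ext_of_isSeparable`). Uniqueness for lifts to `E[[T]][[U]]` gives the iteration rule,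
uniqueness for lifts to `E[[T]]` shows that `θ_E` is unique and commutes with `G`. Moreover, a
constant of `E` has a minimal polynomial over `F` with constant coefficients, so it is algebraic
over the constants `C` of `F`, and it lies in `C` when `E` is geometric over `C`.

*Galois coordinates.* By Dedekind's theorem the matrix `Y = (σⱼ(bᵢ))` of the conjugates of a basis
`b` of `E / F` is invertible. As `θ_E` commutes with `G`, the equation `θ_E(b) = A b` with `A` over
`F[[T]]` gives `θ_E(Y) = A Y`. So `E` is a Picard-Vessiot ring, with fundamental matrix `Y`.
A row of `Y⁻¹` and the basis form elements `aᵢ`, `sᵢ` with `∑ᵢ g(aᵢ) h(sᵢ) = δ_{g,h}`.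

A Picard-Vessiot ring `R` with quotient field `E` is algebraic over `F`, hence equal to `E`. Let
`α` be an automorphism of `R ⊗ D` over `F ⊗ D`. With `ε_g = ∑ᵢ g(aᵢ) α(sᵢ)`, the coordinates give
`α(r) = ∑_g g(r) ε_g`, and the `ε_g` are complete orthogonal idempotents. If `α` commutes with
the iterative derivation then the `ε_g` are constants of `R ⊗ D`, that is, elements of `D`
(`IsGaloisTorsor.exists_twistEquiv_eq`). Families of complete orthogonal idempotents of `D` indexed
by `G` are the `D`-points of `Spec C[G]`, and conversely each of them defines an automorphism
`r ⊗ d ↦ ∑_g g(r) ⊗ e_g d` (`twistEquiv`).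
-/

/-! ### Lifting homomorphisms out of a separable extension -/

section Lifting

variable {F : Type*} {E : Type*} [Field F] [Field E] [Algebra F E]

/-- Formal smoothness along an adically complete ideal, phrased for bare ring homomorphisms: this
leaves the `F`-algebra structure of `S` free, which matters because `E[[T]]` already carries one
different from the one given by `θ`. -/
theorem exists_ringHom_lift_of_isAdicComplete [Algebra.FormallySmooth F E] {S : Type*} [CommRing S]
    (I : Ideal S) [IsAdicComplete I S] (φ : F →+* S) (ψ : E →+* S ⧸ I)
    (h : ψ.comp (algebraMap F E) = (Ideal.Quotient.mk I).comp φ) :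
    ∃ g : E →+* S, g.comp (algebraMap F E) = φ ∧ (Ideal.Quotient.mk I).comp g = ψ := by
  let _ : Algebra F S := φ.toAlgebra
  let f : E →ₐ[F] S ⧸ I := { ψ with commutes' := fun r => RingHom.congr_fun h r }
  obtain ⟨g, hg⟩ := Algebra.FormallySmooth.exists_mkₐ_comp_eq_of_isAdicComplete f
  refine ⟨g.toRingHom, ?_, ?_⟩
  · ext r
    exact g.commutes r
  · ext r
    exact AlgHom.congr_fun hg r

/-- Uniqueness half of Hensel's lemma: the values at `x` are two roots of the minimal polynomial
of `x`, which is separable. -/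
theorem ringHom_ext_of_isSeparable [Algebra.IsSeparable F E] {S : Type*} [CommRing S]
    [IsLocalRing S] {φ ψ : E →+* S}
    (hF : φ.comp (algebraMap F E) = ψ.comp (algebraMap F E))
    (h : ∀ x, ¬ IsUnit (φ x - ψ x)) : φ = ψ := by
  ext x
  have hroot (χ : E →+* S) (q : Polynomial F) :
      (q.map (χ.comp (algebraMap F E))).eval (χ x) = χ (Polynomial.aeval x q) := by
    rw [Polynomial.eval_map, ← Polynomial.hom_eval₂, Polynomial.aeval_def]
  refine IsLocalRing.eq_of_eval_eq_zero_of_not_isUnit_sub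
    (f := (minpoly F x).map (φ.comp (algebraMap F E))) ?_ ?_ (h x) ?_
  · rw [hroot, minpoly.aeval, map_zero]
  · rw [hF, hroot, minpoly.aeval, map_zero]
  · rw [Polynomial.derivative_map, hroot]
    refine (IsUnit.mk0 _ ?_).map φ
    exact (Algebra.IsSeparable.isSeparable F x).aeval_derivative_ne_zero (minpoly.aeval F x)

end Lifting

namespace PowerSeries

variable {R : Type*} [CommRing R]

/-- The Taylor homomorphism `f(T) ↦ f(T + U)`, with values in `R[[T]][[U]]`. -/
noncomputable def taylorHom : R⟦X⟧ →+* R⟦X⟧⟦X⟧ where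
  toFun f := mk fun j => mk fun i => (i + j).choose i • coeff (i + j) f
  map_zero' := by ext; simp
  map_add' f g := by ext; simp
  map_one' := by
    ext j i
    rcases Nat.eq_zero_or_pos j with rfl | hj
    · simp [coeff_one]
    · simp [coeff_one, hj.ne']
  map_mul' f g := by
    ext j i
    -- Only finitely many coefficients matter, so this is the Leibniz rule for the
    -- Hasse derivatives of polynomials.
    have key := congrArg (fun q => Polynomial.coeff q i)
      (Polynomial.hasseDeriv_mul (f := trunc (i + j + 1) f) (g := trunc (i + j + 1) g) j)
    simp only [Polynomial.hasseDeriv_coeff, Polynomial.finsetSum_coeff, Polynomial.coeff_mul]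
      at key
    simp only [coeff_mk, coeff_mul, map_sum, nsmul_eq_mul]
    rw [Nat.choose_symm_add]
    refine Eq.trans ?_ (key.trans ?_)
    · congr 1
      refine Finset.sum_congr rfl fun a ha => ?_
      have := Finset.HasAntidiagonal.mem_antidiagonal.1 ha
      rw [coeff_trunc, coeff_trunc, if_pos (by lia), if_pos (by lia)]
    · refine Finset.sum_congr rfl fun a ha => Finset.sum_congr rfl fun b hb => ?_
      have := Finset.HasAntidiagonal.mem_antidiagonal.1 ha
      have := Finset.HasAntidiagonal.mem_antidiagonal.1 hb
      rw [coeff_trunc, coeff_trunc, if_pos (by lia), if_pos (by lia), Nat.choose_symm_add,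
        Nat.choose_symm_add]

theorem coeff_coeff_taylorHom (i j : ℕ) (f : R⟦X⟧) :
    coeff i (coeff j (taylorHom f)) = (i + j).choose i • coeff (i + j) f := by
  simp [taylorHom]

end PowerSeries

namespace IterativeDerivation

section Basic

variable {R : Type*} [CommRing R] (θ : IterativeDerivation R)

theorem coeff_toRingHom (k : ℕ) (r : R) : PowerSeries.coeff k (θ.toRingHom r) = θ.der k r := rfl

@[simp]
theorem der_zero (r : R) : θ.der 0 r = r := θ.coeff_zero r

theorem der_der (i j : ℕ) (r : R) :
    θ.der i (θ.der j r) = (i + j).choose i • θ.der (i + j) r := θ.coeff_coeff i j r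

theorem der_mul (k : ℕ) (r s : R) :
    θ.der k (r * s) =
      ∑ ij ∈ Finset.HasAntidiagonal.antidiagonal k, θ.der ij.1 r * θ.der ij.2 s := by
  rw [← coeff_toRingHom, map_mul, PowerSeries.coeff_mul]
  rfl

theorem der_one {k : ℕ} (hk : k ≠ 0) : θ.der k 1 = 0 := by
  rw [← coeff_toRingHom, map_one, PowerSeries.coeff_one, if_neg hk]

theorem mem_constants_iff {r : R} : r ∈ θ.constants ↔ ∀ k ≠ 0, θ.der k r = 0 := by
  change θ.toRingHom r = PowerSeries.C r ↔ _
  refine ⟨fun h k hk => ?_, fun h => ?_⟩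
  · rw [← coeff_toRingHom, h, PowerSeries.coeff_C, if_neg hk]
  · ext k
    rcases eq_or_ne k 0 with rfl | hk
    · rw [θ.coeff_zero, PowerSeries.coeff_zero_C]
    · rw [coeff_toRingHom, h k hk, PowerSeries.coeff_C, if_neg hk]

theorem Extends.der_algebraMap {θ : IterativeDerivation R} {S : Type*} [CommRing S] [Algebra R S]
    {θS : IterativeDerivation S} (h : θS.Extends θ) (k : ℕ) (r : R) :
    θS.der k (algebraMap R S r) = algebraMap R S (θ.der k r) := by
  rw [← coeff_toRingHom, h, PowerSeries.coeff_map, coeff_toRingHom]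

end Basic

/-! ### Iterative derivations on separable extensions -/

section Separable

variable {F : Type u} {E : Type v} [Field F] [Field E] [Algebra F E] [Algebra.IsSeparable F E]
  {θ : IterativeDerivation F}

theorem powerSeries_ringHom_ext {φ ψ : E →+* E⟦X⟧}
    (hF : φ.comp (algebraMap F E) = ψ.comp (algebraMap F E))
    (h : ∀ x, PowerSeries.coeff 0 (φ x) = PowerSeries.coeff 0 (ψ x)) : φ = ψ := by
  refine ringHom_ext_of_isSeparable hF fun x hx => ?_
  rw [PowerSeries.isUnit_iff_constantCoeff, ← PowerSeries.coeff_zero_eq_constantCoeff_apply,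
    map_sub, h, sub_self] at hx
  exact not_isUnit_zero hx

theorem Extends.eq_of_isSeparable {θ₁ θ₂ : IterativeDerivation E} (h₁ : θ₁.Extends θ)
    (h₂ : θ₂.Extends θ) : θ₁ = θ₂ := by
  refine IterativeDerivation.ext (powerSeries_ringHom_ext (F := F) ?_ fun x => ?_)
  · ext1 r
    exact (h₁ r).trans (h₂ r).symm
  · rw [θ₁.coeff_zero, θ₂.coeff_zero]

/-- By uniqueness of lifts, every `F`-automorphism is an ID-automorphism. -/
theorem Extends.der_algEquiv {θE : IterativeDerivation E} (h : θE.Extends θ) (σ : E ≃ₐ[F] E)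
    (k : ℕ) (x : E) : θE.der k (σ x) = σ (θE.der k x) := by
  have key : θE.toRingHom.comp (σ : E →+* E) =
      (PowerSeries.map (σ : E →+* E)).comp θE.toRingHom := by
    refine powerSeries_ringHom_ext (F := F) ?_ fun x => ?_
    · ext r n
      simp only [RingHom.comp_apply, PowerSeries.coeff_map, RingHom.coe_coe, AlgEquiv.commutes]
      rw [h r, PowerSeries.coeff_map, AlgEquiv.commutes]
    · simp only [RingHom.comp_apply, PowerSeries.coeff_map, θE.coeff_zero]
  have := congrArg (PowerSeries.coeff k) (RingHom.congr_fun key x)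
  simpa only [RingHom.comp_apply, PowerSeries.coeff_map, coeff_toRingHom, RingHom.coe_coe]
    using this

theorem exists_extends_of_isSeparable (θ : IterativeDerivation F) :
    ∃ θE : IterativeDerivation E, θE.Extends θ := by
  have : Algebra.FormallyEtale F E := Algebra.FormallyEtale.of_isSeparable F E
  let I : Ideal E⟦X⟧ := Ideal.span {PowerSeries.X}
  have hI {f g : E⟦X⟧} : Ideal.Quotient.mk I f = Ideal.Quotient.mk I g ↔
      PowerSeries.coeff 0 f = PowerSeries.coeff 0 g := by
    rw [Ideal.Quotient.mk_eq_mk_iff_sub_mem, Ideal.mem_span_singleton, PowerSeries.X_dvd_iff,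
      ← PowerSeries.coeff_zero_eq_constantCoeff_apply, map_sub, sub_eq_zero]
  obtain ⟨g, hgF, hg⟩ := exists_ringHom_lift_of_isAdicComplete (F := F) (E := E) I
    ((PowerSeries.map (algebraMap F E)).comp θ.toRingHom)
    ((Ideal.Quotient.mk I).comp (PowerSeries.C (R := E))) (by
      ext1 r
      refine hI.2 ?_
      rw [RingHom.comp_apply, PowerSeries.coeff_map, θ.coeff_zero, PowerSeries.coeff_zero_C])
  have hg0 (x : E) : PowerSeries.coeff 0 (g x) = x := by
    rw [hI.1 (RingHom.congr_fun hg x), PowerSeries.coeff_zero_C]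
  have hgF' (r : F) : g (algebraMap F E r) = PowerSeries.map (algebraMap F E) (θ.toRingHom r) :=
    RingHom.congr_fun hgF r
  -- Iterativity says that the two lifts `(θ[[U]]) ∘ θ` and `θ_{T + U}` of the identity agree.
  have key : (PowerSeries.map g).comp g = PowerSeries.taylorHom.comp g := by
    refine ringHom_ext_of_isSeparable (F := F) ?_ fun x hx => ?_
    · ext r j i
      simp only [RingHom.comp_apply, PowerSeries.coeff_map, PowerSeries.coeff_coeff_taylorHom,
        hgF']
      rw [θ.coeff_coeff, map_nsmul]
    · rw [PowerSeries.isUnit_iff_constantCoeff, PowerSeries.isUnit_iff_constantCoeff,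
        ← PowerSeries.coeff_zero_eq_constantCoeff_apply,
        ← PowerSeries.coeff_zero_eq_constantCoeff_apply, map_sub, map_sub] at hx
      simp only [RingHom.comp_apply, PowerSeries.coeff_map, PowerSeries.coeff_coeff_taylorHom,
        hg0] at hx
      simp [-PowerSeries.coeff_zero_eq_constantCoeff] at hx
  refine ⟨⟨g, hg0, fun i j r => ?_⟩, hgF'⟩
  have := congrArg (fun f => PowerSeries.coeff i (PowerSeries.coeff j f)) (RingHom.congr_fun key r)
  simpa only [RingHom.comp_apply, PowerSeries.coeff_map, PowerSeries.coeff_coeff_taylorHom]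
    using this

/-- The minimal polynomial over `F` of a constant has constant coefficients, because its
coefficientwise derivatives vanish at the constant and have smaller degree. -/
theorem Extends.isAlgebraic_of_mem_constants {θE : IterativeDerivation E} (h : θE.Extends θ)
    {c : E} (hc : c ∈ θE.constants) : IsAlgebraic θ.constantField c := by
  have hint : IsIntegral F c := (Algebra.IsSeparable.isSeparable F c).isIntegral
  set f := minpoly F c with hf
  have hmonic : f.Monic := minpoly.monic hint
  -- Applying `θ⁽ᵏ⁾` to `f(c) = 0`.
  have hder (k : ℕ) : ∑ i ∈ Finset.range (f.natDegree + 1),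
      algebraMap F E (θ.der k (f.coeff i)) * c ^ i = 0 := by
    have h0 := congrArg (fun y => PowerSeries.coeff k (θE.toRingHom y)) (minpoly.aeval F c)
    simp only [Polynomial.aeval_eq_sum_range, map_sum, map_zero, Algebra.smul_def, map_mul,
      map_pow] at h0
    rw [← h0]
    refine Finset.sum_congr rfl fun i _ => ?_
    have hc' : θE.toRingHom c = PowerSeries.C c := hc
    rw [hc', ← map_pow, PowerSeries.coeff_mul_C, h, PowerSeries.coeff_map, coeff_toRingHom]
  have hconst (i : ℕ) : f.coeff i ∈ θ.constantField := by
    refine (θ.mem_constants_iff (r := f.coeff i)).2 fun k hk => ?_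
    by_cases hi : i < f.natDegree
    · let q : Polynomial F := ∑ j ∈ Finset.range f.natDegree,
        Polynomial.C (θ.der k (f.coeff j)) * Polynomial.X ^ j
      have hq : Polynomial.aeval c q = 0 := by
        have := hder k
        rw [Finset.sum_range_succ, hmonic.coeff_natDegree, θ.der_one hk, map_zero, zero_mul,
          add_zero] at this
        simpa [q, map_sum] using this
      have hdeg : q.degree < f.degree := by
        rw [Polynomial.degree_eq_natDegree hmonic.ne_zero]
        refine (Polynomial.degree_sum_le _ _).trans_lt
          ((Finset.sup_lt_iff (WithBot.bot_lt_coe _)).2 fun j hj => ?_)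
        refine (Polynomial.degree_C_mul_X_pow_le j _).trans_lt ?_
        exact_mod_cast Finset.mem_range.1 hj
      have hq0 : q = 0 := by
        by_contra hne
        exact absurd (minpoly.degree_le_of_ne_zero F c hne hq) (not_le.2 hdeg)
      have := congrArg (fun q => Polynomial.coeff q i) hq0
      simpa [q, Polynomial.finsetSum_coeff, Polynomial.coeff_X_pow, hi] using this
    · rcases (not_lt.1 hi).eq_or_lt with rfl | hlt
      · rw [hmonic.coeff_natDegree, θ.der_one hk]
      · rw [Polynomial.coeff_eq_zero_of_natDegree_lt hlt, map_zero]
  have hlift : f ∈ Polynomial.lifts (algebraMap θ.constantField F) := by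
    rw [Polynomial.lifts_iff_coeff_lifts]
    exact fun i => ⟨⟨_, hconst i⟩, rfl⟩
  obtain ⟨q, hq⟩ := (Polynomial.mem_lifts _).1 hlift
  refine ⟨q, ?_, ?_⟩
  · rintro rfl
    exact hmonic.ne_zero (by rw [← hq, Polynomial.map_zero])
  · rw [← Polynomial.aeval_map_algebraMap F, hq, minpoly.aeval]

theorem Extends.constants_eq {θE : IterativeDerivation E} (h : θE.Extends θ)
    (hgeo : IsGeometricOver θ.constantField E) :
    θE.constants = θ.constants.map (algebraMap F E) := by
  ext c
  refine ⟨fun hc => ?_, ?_⟩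
  · obtain ⟨d, rfl⟩ := hgeo c (h.isAlgebraic_of_mem_constants hc)
    exact ⟨d, d.2, rfl⟩
  · rintro ⟨d, hd, rfl⟩
    refine θE.mem_constants_iff.2 fun k hk => ?_
    rw [h.der_algebraMap, θ.mem_constants_iff.1 hd k hk, map_zero]

end Separable

end IterativeDerivation

/-! ### Galois coordinates -/

section GaloisCoordinates

variable {F : Type*} {E : Type*} [Field F] [Field E] [Algebra F E]

/-- The matrix `(σⱼ(bᵢ))` of a basis `b` is invertible, by Dedekind's independence of
automorphisms. -/
theorem isUnit_of_basis_algEquiv {ι : Type*} [Fintype ι] [DecidableEq ι] (b : Module.Basis ι F E)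
    (e : ι ≃ (E ≃ₐ[F] E)) : IsUnit (Matrix.of fun i j => e j (b i)) := by
  rw [← Matrix.mulVec_injective_iff_isUnit]
  refine (injective_iff_map_eq_zero (Matrix.mulVecLin _)).2 fun c hc => ?_
  have hind := (linearIndependent_toLinearMap F E E).comp
    (fun j => ((e j : E ≃ₐ[F] E) : E →ₐ[F] E))
    (fun j j' h => e.injective (AlgEquiv.ext fun x => AlgHom.congr_fun h x))
  refine funext (Fintype.linearIndependent_iff.1 hind c (b.ext fun i => ?_))
  have := congrFun hc i
  simpa [Matrix.mulVec, dotProduct, mul_comm] using this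

variable [FiniteDimensional F E] [IsGalois F E]

variable (F E) in
theorem exists_basis_equiv_algEquiv :
    Nonempty (Fin (Module.finrank F E) ≃ (E ≃ₐ[F] E)) :=
  ⟨Fintype.equivOfCardEq (by
    rw [Fintype.card_fin, ← Nat.card_eq_fintype_card, IsGalois.card_aut_eq_finrank])⟩

variable (F E) in
open Classical in
/-- Galois coordinates: a basis of `E` over `F` and a row of the inverse of its matrix of
conjugates. -/
theorem exists_galoisCoordinates : ∃ (n : ℕ) (a s : Fin n → E),
    ∀ g h : E ≃ₐ[F] E, ∑ i, g (a i) * h (s i) = if g = h then 1 else 0 := by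
  obtain ⟨e⟩ := exists_basis_equiv_algEquiv F E
  let b := Module.finBasis F E
  set Y : Matrix _ _ E := Matrix.of fun i j => e j (b i) with hY
  have hYu : IsUnit Y.det := (Matrix.isUnit_iff_isUnit_det _).1 (isUnit_of_basis_algEquiv b e)
  -- The row of `Y⁻¹` indexed by the identity.
  refine ⟨_, fun i => Y⁻¹ (e.symm 1) i, b, fun g h => ?_⟩
  have key : ∑ i, Y⁻¹ (e.symm 1) i * (g⁻¹ * h) (b i) = if g = h then 1 else 0 := by
    have := congrFun (congrFun (Matrix.nonsing_inv_mul Y hYu) (e.symm 1)) (e.symm (g⁻¹ * h))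
    rw [Matrix.mul_apply, Matrix.one_apply] at this
    simpa [hY, eq_inv_mul_iff_mul_eq] using this
  have := congrArg (fun x => g x) key
  simpa only [map_sum, map_mul, ← AlgEquiv.mul_apply, mul_inv_cancel_left, apply_ite g,
    (map_one g : g (1 : E) = 1), map_zero] using this

end GaloisCoordinates

/-! ### Finite Galois extensions are Picard-Vessiot -/

namespace IterativeDerivation

variable {F : Type u} {E : Type v} [Field F] [Field E] [Algebra F E]
  {θ : IterativeDerivation F} {θE : IterativeDerivation E}

section Basis

variable {n : ℕ} (θE) (b : Module.Basis (Fin n) F E)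

/-- The matrix `A` over `F[[T]]` with `θ(b) = A b`, for a basis `b` of `E` over `F`. -/
noncomputable def basisMatrix : Matrix (Fin n) (Fin n) F⟦X⟧ :=
  Matrix.of fun i j => PowerSeries.mk fun k => b.repr (θE.der k (b i)) j

theorem coeff_basisMatrix (k : ℕ) (i j : Fin n) :
    PowerSeries.coeff k (basisMatrix θE b i j) = b.repr (θE.der k (b i)) j := by
  simp [basisMatrix]

theorem sum_coeff_basisMatrix_smul (k : ℕ) (i : Fin n) :
    ∑ j, PowerSeries.coeff k (basisMatrix θE b i j) • b j = θE.der k (b i) := by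
  simp only [coeff_basisMatrix]
  exact b.sum_repr _

theorem basisMatrix_map_coeff_zero :
    (basisMatrix θE b).map (PowerSeries.coeff 0) = 1 := by
  ext i j
  rw [Matrix.map_apply, coeff_basisMatrix, der_zero, b.repr_self, Matrix.one_apply,
    Finsupp.single_apply]

theorem isUnit_basisMatrix : IsUnit (basisMatrix θE b) := by
  rw [Matrix.isUnit_iff_isUnit_det, PowerSeries.isUnit_iff_constantCoeff, RingHom.map_det]
  have := basisMatrix_map_coeff_zero θE b
  rw [PowerSeries.coeff_zero_eq_constantCoeff] at this
  rw [RingHom.mapMatrix_apply, this, Matrix.det_one]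
  exact isUnit_one

variable {θE}

/-- The iterative differential equation satisfied by a basis of `E` over `F`. -/
noncomputable def Extends.basisIDE (h : θE.Extends θ) : θ.IDE n where
  A := (isUnit_basisMatrix θE b).unit
  coeff_zero := basisMatrix_map_coeff_zero θE b
  compat k l := by
    rw [IsUnit.unit_spec]
    -- Both sides are the coordinates of `θ⁽ˡ⁾(θ⁽ᵏ⁾(b))`.
    suffices H : ∀ i, ∑ j, ((k + l).choose l •
          (basisMatrix θE b).map (PowerSeries.coeff (k + l))) i j • b j =
        ∑ j, (∑ uv ∈ Finset.HasAntidiagonal.antidiagonal l,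
          (((basisMatrix θE b).map (PowerSeries.coeff k)).map (θ.der uv.1)) *
            (basisMatrix θE b).map (PowerSeries.coeff uv.2)) i j • b j by
      ext i j
      have := congrArg (fun x => b.repr x j) (H i)
      simpa only [b.repr_sum_self] using this
    intro i
    trans θE.der l (θE.der k (b i))
    · simp only [Matrix.smul_apply, smul_assoc, ← Finset.smul_sum, Matrix.map_apply]
      rw [sum_coeff_basisMatrix_smul, der_der, add_comm l k]
    · simp only [Matrix.sum_apply, Matrix.mul_apply, Matrix.map_apply, Finset.sum_smul, mul_smul]
      rw [← sum_coeff_basisMatrix_smul θE b k i, map_sum, Finset.sum_comm]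
      simp_rw [Algebra.smul_def _ (b _), der_mul, h.der_algebraMap]
      rw [Finset.sum_comm]
      refine Finset.sum_congr rfl fun uv _ => ?_
      rw [Finset.sum_comm]
      refine Finset.sum_congr rfl fun j _ => ?_
      rw [← sum_coeff_basisMatrix_smul θE b uv.2 j, Finset.mul_sum]
      simp_rw [Algebra.smul_def]

end Basis

theorem isIDSimple_of_field (θE : IterativeDerivation E) : θE.IsIDSimple :=
  ⟨inferInstance, fun I _ => eq_bot_or_eq_top I⟩

variable [FiniteDimensional F E] [IsGalois F E]

/-- The fundamental solution matrix is formed by the conjugates of a basis. -/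
theorem Extends.isPVRing (h : θE.Extends θ) (hgeo : IsGeometricOver θ.constantField E) :
    (h.basisIDE (Module.finBasis F E)).IsPVRing θE where
  isExtension := h
  isIDSimple := isIDSimple_of_field θE
  constants_eq := h.constants_eq hgeo
  exists_solution := by
    obtain ⟨e⟩ := exists_basis_equiv_algEquiv F E
    let b := Module.finBasis F E
    refine ⟨(isUnit_of_basis_algEquiv b e).unit, ?_, ?_⟩
    · change Matrix.map (Matrix.of fun i j => e j (b i)) _ = (basisMatrix θE b).map _ *
        Matrix.map (Matrix.of fun i j => e j (b i)) _
      ext i j k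
      rw [Matrix.mul_apply, map_sum]
      simp only [Matrix.map_apply, Matrix.of_apply, PowerSeries.coeff_mul_C, PowerSeries.coeff_map,
        coeff_toRingHom]
      rw [h.der_algEquiv, ← sum_coeff_basisMatrix_smul θE b k i, map_sum]
      refine Finset.sum_congr rfl fun l _ => ?_
      rw [map_smul, Algebra.smul_def]
    · rw [← Algebra.toSubmodule_eq_top, eq_top_iff, ← b.span_eq,
        Submodule.span_le]
      rintro _ ⟨i, rfl⟩
      exact Algebra.subset_adjoin (Or.inl ⟨i, e.symm 1, by simp⟩)

/-- `E` is its own Picard-Vessiot ring. -/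
theorem Extends.isPVExtension (h : θE.Extends θ) (hgeo : IsGeometricOver θ.constantField E) :
    θ.IsPVExtension θE :=
  ⟨E, inferInstance, inferInstance, inferInstance, inferInstance, θE,
    ⟨_, _, h.isPVRing hgeo⟩, inferInstance, fun r => by
      rw [Algebra.algebraMap_self, PowerSeries.map_id]; rfl⟩

end IterativeDerivation

/-! ### Points of the constant group scheme as families of idempotents -/

namespace ConstGroupRing

variable {C : Type u} {G : Type v} [CommRing C] [Fintype G] {D : Type w} [CommRing D] [Algebra C D]

variable (C G) in
theorem completeOrthogonalIdempotents_delta :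
    CompleteOrthogonalIdempotents (delta C : G → ConstGroupRing C G) := by
  classical
  refine CompleteOrthogonalIdempotents.iff_ortho_complete.2 ⟨fun g h hgh => ?_, sum_delta C⟩
  change delta C g * delta C h = 0
  rw [delta_mul_delta, if_neg hgh]

/-- A family of complete orthogonal idempotents of `D` indexed by `G` is a `D`-point of the
constant group scheme of `G`. -/
noncomputable def ofIdempotents {e : G → D} (he : CompleteOrthogonalIdempotents e) :
    ConstGroupRing C G →ₐ[C] D :=
  AlgHom.ofLinearMap (∑ g, (eval C g).toLinearMap.smulRight (e g))
    (by simp [LinearMap.sum_apply, he.complete])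
    (by
      classical
      intro f f'
      simp only [LinearMap.sum_apply, LinearMap.smulRight_apply, AlgHom.toLinearMap_apply, map_mul,
        Finset.sum_mul_sum, smul_mul_smul_comm, he.mul_eq, smul_ite, smul_zero,
        Finset.sum_ite_eq, Finset.mem_univ, if_true])

theorem ofIdempotents_delta {e : G → D} (he : CompleteOrthogonalIdempotents e) (g : G) :
    ofIdempotents (C := C) he (delta C g) = e g := by
  classical
  simp [ofIdempotents, eval_delta, LinearMap.sum_apply, Finset.sum_ite_eq']

/-- Convolution of points, in terms of their values on the indicator functions, is multiplication
in the group algebra `D[G]`. -/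
theorem convMul_delta [Group G] (φ ψ : WithConv (ConstGroupRing C G →ₐ[C] D)) (k : G) :
    (φ * ψ).ofConv (delta C k) =
      ∑ g, φ.ofConv (delta C g) * ψ.ofConv (delta C (g⁻¹ * k)) := by
  have : CoalgebraStruct.comul (R := C) (delta C k) =
    ∑ g : G, delta C g ⊗ₜ[C] delta C (g⁻¹ * k) := comulLin_delta C G k
  rw [AlgHom.convMul_apply, this]
  simp

end ConstGroupRing

namespace IterativeDerivation

/-! ### Twisting a group action by idempotents -/

section Twist

variable {K : Type u} {R : Type v} [CommRing K] [CommRing R] [Algebra K R]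
  {G : Type x} [Group G] [Fintype G] (ρ : G →* (R ≃ₐ[K] R)) {D : Type w} [CommRing D] [Algebra K D]

/-- The endomorphism `r ⊗ d ↦ ∑_g g(r) ⊗ e_g d` of `R ⊗ D` attached to complete orthogonal
idempotents `e_g` of `D`: on the factor of `D` cut out by `e_g`, it is the action of `g`. -/
noncomputable def twist {e : G → D} (he : CompleteOrthogonalIdempotents e) :
    R ⊗[K] D →ₐ[K] R ⊗[K] D :=
  Algebra.TensorProduct.lift
    (AlgHom.ofLinearMap (∑ g, ((TensorProduct.mk K R D).flip (e g)) ∘ₗ (ρ g).toLinearMap)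
      (by
        simp only [LinearMap.sum_apply, LinearMap.comp_apply, LinearMap.flip_apply,
          TensorProduct.mk_apply, AlgEquiv.toLinearMap_apply, map_one]
        rw [← TensorProduct.tmul_sum, he.complete]
        rfl)
      (by
        classical
        intro r s
        simp only [LinearMap.sum_apply, LinearMap.comp_apply, LinearMap.flip_apply,
          TensorProduct.mk_apply, AlgEquiv.toLinearMap_apply, map_mul, Finset.sum_mul_sum,
          Algebra.TensorProduct.tmul_mul_tmul, he.mul_eq, apply_ite, TensorProduct.tmul_zero,
          Finset.sum_ite_eq, Finset.mem_univ, if_true]))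
    Algebra.TensorProduct.includeRight (fun _ _ => Commute.all _ _)

theorem twist_tmul {e : G → D} (he : CompleteOrthogonalIdempotents e) (r : R) (d : D) :
    twist ρ he (r ⊗ₜ d) = ∑ g, ρ g r ⊗ₜ[K] (e g * d) := by
  simp [twist, LinearMap.sum_apply, Finset.sum_mul]

theorem twist_twist_tmul {e f : G → D} (he : CompleteOrthogonalIdempotents e)
    (hf : CompleteOrthogonalIdempotents f) (r : R) (d : D) :
    twist ρ he (twist ρ hf (r ⊗ₜ d)) =
      ∑ k, ρ k r ⊗ₜ[K] ((∑ g, e g * f (g⁻¹ * k)) * d) := by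
  simp only [twist_tmul, map_sum, Finset.sum_mul, TensorProduct.tmul_sum]
  rw [Finset.sum_comm]
  conv_rhs => rw [Finset.sum_comm]
  refine Finset.sum_congr rfl fun g _ => ?_
  refine Fintype.sum_equiv (Equiv.mulLeft g) _ _ fun h => ?_
  simp [mul_assoc, AlgEquiv.mul_apply]

/-- The automorphism of `R ⊗ D` attached to complete orthogonal idempotents `e_g` of `D`; its
inverse is attached to the idempotents `e_{g⁻¹}`. -/
noncomputable def twistEquiv {e : G → D} (he : CompleteOrthogonalIdempotents e) :
    (R ⊗[K] D) ≃ₐ[K] (R ⊗[K] D) :=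
  have he' : CompleteOrthogonalIdempotents fun g => e g⁻¹ :=
    (CompleteOrthogonalIdempotents.equiv (Equiv.inv G)).2 he
  have key {e f : G → D} (he : CompleteOrthogonalIdempotents e)
      (hf : CompleteOrthogonalIdempotents f) (hef : ∀ g, f g⁻¹ = e g) :
      (twist ρ he).comp (twist ρ hf) = AlgHom.id K _ := by
    classical
    refine AlgHom.toLinearMap_injective (TensorProduct.ext' fun r d => ?_)
    change twist ρ he (twist ρ hf (r ⊗ₜ d)) = r ⊗ₜ d
    rw [twist_twist_tmul, Finset.sum_eq_single 1]
    · simp [hef, he.mul_eq, he.complete]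
    · intro k _ hk
      have : ∑ g, e g * f (g⁻¹ * k) = 0 := by
        refine Finset.sum_eq_zero fun g _ => ?_
        have := hef (k⁻¹ * g)
        rw [mul_inv_rev, inv_inv] at this
        rw [this, he.mul_eq, if_neg]
        simpa [eq_comm] using hk
      rw [this, zero_mul, TensorProduct.tmul_zero]
    · simp
  AlgEquiv.ofAlgHom (twist ρ he) (twist ρ he')
    (key he he' fun g => by simp) (key he' he fun g => by simp)

theorem twistEquiv_tmul {e : G → D} (he : CompleteOrthogonalIdempotents e) (r : R) (d : D) :
    twistEquiv ρ he (r ⊗ₜ d) = ∑ g, ρ g r ⊗ₜ[K] (e g * d) :=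
  twist_tmul ρ he r d

end Twist

section TensorTrivial

variable {K : Type u} {R : Type v} [CommRing R]
  (θ : IterativeDerivation R)

@[simp]
theorem der_tensorTrivial_tmul [CommRing K] [Algebra K R]
    (hθ : ∀ c : K, θ.toRingHom (algebraMap K R c) = PowerSeries.C (algebraMap K R c))
    (D : Type w) [CommRing D] [Algebra K D] (k : ℕ) (r : R) (d : D) :
    (θ.tensorTrivial hθ D).der k (r ⊗ₜ d) = θ.der k r ⊗ₜ[K] d :=
  θ.coeff_tensorTrivialHom_tmul hθ D k r d

/-- If the constants of `R` are exactly `K`, then those of `R ⊗ D` are `D`: the coordinates of a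
constant with respect to a `K`-basis of `D` are constants of `R`. -/
theorem mem_range_includeRight_of_der_eq_zero [Field K] [Algebra K R]
    (hθ : ∀ c : K, θ.toRingHom (algebraMap K R c) = PowerSeries.C (algebraMap K R c))
    (hconst : ∀ r ∈ θ.constants, r ∈ Set.range (algebraMap K R))
    (D : Type w) [CommRing D] [Algebra K D] {x : R ⊗[K] D}
    (hx : ∀ k ≠ 0, (θ.tensorTrivial hθ D).der k x = 0) :
    ∃ d : D, (1 : R) ⊗ₜ[K] d = x := by
  let b := Module.Basis.ofVectorSpace K D
  let B := Algebra.TensorProduct.basis R b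
  have hrepr (k : ℕ) (y : R ⊗[K] D) (i) :
      B.repr ((θ.tensorTrivial hθ D).der k y) i = θ.der k (B.repr y i) := by
    induction y with
    | zero => simp
    | add y z hy hz => simp only [map_add, Finsupp.add_apply, hy, hz]
    | tmul r d =>
      have hc (c : K) : θ.der k (r * algebraMap K R c) = θ.der k r * algebraMap K R c := by
        rw [← coeff_toRingHom, map_mul, hθ, PowerSeries.coeff_mul_C, coeff_toRingHom]
      simp [B, Algebra.TensorProduct.basis_repr_tmul, hc]
  have hcoord (i) : ∃ c : K, algebraMap K R c = B.repr x i := by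
    refine hconst _ (θ.mem_constants_iff.2 fun k hk => ?_)
    rw [← hrepr, hx k hk]
    simp
  choose c hc using hcoord
  refine ⟨∑ i ∈ (B.repr x).support, c i • b i, ?_⟩
  conv_rhs => rw [← B.linearCombination_repr x, Finsupp.linearCombination_apply, Finsupp.sum]
  rw [TensorProduct.tmul_sum]
  refine Finset.sum_congr rfl fun i _ => ?_
  rw [← hc, TensorProduct.tmul_smul, Algebra.TensorProduct.basis_apply, algebraMap_smul]

end TensorTrivial

/-! ### The Galois group scheme of a torsor under a constant group -/

section Torsor

variable {F : Type u} [Field F] {θ : IterativeDerivation F}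
  {R : Type v} [CommRing R] [Algebra F R] {θR : IterativeDerivation R}
  {G : Type x} [Group G] [Fintype G]

open Classical in
/-- The finite group `G` acts on the ID-ring `R` over `F` by ID-automorphisms, the constants of
`R` are those of `F`, and `R` is a Galois extension of `F` with group `G` in the sense of
commutative rings: `F` is the ring of invariants and there are Galois coordinates, i.e. elements
`aᵢ`, `sᵢ` such that `∑ᵢ g(aᵢ) h(sᵢ)` is `1` if `g = h` and `0` otherwise. -/
structure IsGaloisTorsor (θ : IterativeDerivation F) (θR : IterativeDerivation R)
    (ρ : G →* (R ≃ₐ[F] R)) : Prop where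
  nontrivial : Nontrivial R
  der_apply : ∀ (g : G) (k : ℕ) (r : R), θR.der k (ρ g r) = ρ g (θR.der k r)
  mem_range_of_mem_constants : ∀ r ∈ θR.constants, r ∈ Set.range (algebraMap θ.constantField R)
  mem_range_of_fixed : ∀ r, (∀ g, ρ g r = r) → r ∈ Set.range (algebraMap F R)
  exists_coordinates : ∃ (n : ℕ) (a s : Fin n → R),
    ∀ g h, ∑ i, ρ g (a i) * ρ h (s i) = if g = h then 1 else 0

/-- An action by `F`-algebra automorphisms, regarded over the field of constants. -/
noncomputable def constAction (θ : IterativeDerivation F) (ρ : G →* (R ≃ₐ[F] R)) :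
    G →* (R ≃ₐ[θ.constantField] R) where
  toFun g := (ρ g).restrictScalars θ.constantField
  map_one' := by rw [map_one]; rfl
  map_mul' g h := by rw [map_mul]; rfl

omit [Fintype G] in
theorem constAction_apply (θ : IterativeDerivation F) (ρ : G →* (R ≃ₐ[F] R)) (g : G) (r : R) :
    constAction θ ρ g r = ρ g r := rfl

variable {ρ : G →* (R ≃ₐ[F] R)} (hρ : IsGaloisTorsor θ θR ρ) (h : θR.Extends θ)
  {D : Type w} [CommRing D] [Algebra θ.constantField D]

include hρ

theorem IsGaloisTorsor.twistEquiv_mem_idAut {e : G → D} (he : CompleteOrthogonalIdempotents e) :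
    twistEquiv (constAction θ ρ) he ∈ idAut h D := by
  refine ⟨fun x => ?_, fun k x => ?_⟩
  · induction x with
    | zero => simp
    | add x y hx hy => rw [map_add, map_add, hx, hy]
    | tmul f d =>
      have (g : G) : ρ g (algebraMap F R f) = algebraMap F R f := (ρ g).commutes f
      simp [twistEquiv_tmul, constAction_apply, this, ← TensorProduct.tmul_sum, ← Finset.sum_mul,
        he.complete]
  · induction x with
    | zero => simp
    | add x y hx hy => simp only [map_add, hx, hy]
    | tmul r d =>
      simp [twistEquiv_tmul, constAction_apply, hρ.der_apply]

omit [Fintype G] in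
theorem IsGaloisTorsor.includeRight_injective :
    Function.Injective fun d : D => (1 : R) ⊗ₜ[θ.constantField] d := by
  have := hρ.nontrivial
  exact Algebra.TensorProduct.includeRight_injective
    (algebraMap θ.constantField R).injective

/-- Galois coordinates recover the idempotents from the automorphism. -/
theorem IsGaloisTorsor.eq_of_twistEquiv_eq {e f : G → D} (he : CompleteOrthogonalIdempotents e)
    (hf : CompleteOrthogonalIdempotents f)
    (hef : twistEquiv (constAction θ ρ) he = twistEquiv (constAction θ ρ) hf) : e = f := by
  classical
  obtain ⟨n, a, s, has⟩ := hρ.exists_coordinates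
  have key {e : G → D} (he : CompleteOrthogonalIdempotents e) (g : G) :
      ∑ i, (ρ g (a i) ⊗ₜ[θ.constantField] (1 : D)) *
        twistEquiv (constAction θ ρ) he (s i ⊗ₜ 1) = 1 ⊗ₜ e g := by
    simp only [twistEquiv_tmul, constAction_apply, Finset.mul_sum,
      Algebra.TensorProduct.tmul_mul_tmul]
    rw [Finset.sum_comm]
    simp only [← TensorProduct.sum_tmul, has, one_mul, mul_one]
    rw [Finset.sum_eq_single g]
    · rw [if_pos rfl]
    · intro k _ hk
      rw [if_neg hk.symm, TensorProduct.zero_tmul]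
    · simp
  funext g
  refine hρ.includeRight_injective (D := D) ?_
  change (1 : R) ⊗ₜ[θ.constantField] e g = 1 ⊗ₜ f g
  rw [← key he, ← key hf, hef]

/-- Every ID-automorphism comes from idempotents. Its restriction to `R` is a combination
`∑ ε_g g` of the elements of `G`, with coefficients read off by Galois coordinates; being
compatible with `θ`, it has constant coefficients, which therefore lie in `D`. -/
theorem IsGaloisTorsor.exists_twistEquiv_eq
    {α : (R ⊗[θ.constantField] D) ≃ₐ[θ.constantField] (R ⊗[θ.constantField] D)}
    (hα : α ∈ idAut h D) :
    ∃ (e : G → D) (he : CompleteOrthogonalIdempotents e),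
      twistEquiv (constAction θ ρ) he = α := by
  classical
  obtain ⟨n, a, s, has⟩ := hρ.exists_coordinates
  let inl : R →ₐ[θ.constantField] R ⊗[θ.constantField] D := Algebra.TensorProduct.includeLeft
  have hinl (r : R) : inl r = r ⊗ₜ 1 := rfl
  have hder (k : ℕ) (r : R) :
      (θR.tensorTrivial h.algebraMap_constantField D).der k (inl r) = inl (θR.der k r) :=
    der_tensorTrivial_tmul θR h.algebraMap_constantField D k r 1
  have hαF (f : F) : α (inl (algebraMap F R f)) = inl (algebraMap F R f) := by
    simpa [hinl] using hα.1 (f ⊗ₜ 1)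
  have hαD (d : D) : α (1 ⊗ₜ d) = 1 ⊗ₜ d := by
    simpa using hα.1 (1 ⊗ₜ d)
  obtain ⟨ε, hε⟩ : ∃ ε : G → R ⊗[θ.constantField] D,
      ∀ g, ε g = ∑ i, inl (ρ g (a i)) * α (inl (s i)) := ⟨_, fun _ => rfl⟩
  -- The trace form expresses `r` through the `s i`, with coefficients in `F`.
  have hexp (r : R) : α (inl r) = ∑ g, inl (ρ g r) * ε g := by
    have htr (x : R) : ∃ f : F, algebraMap F R f = ∑ g, ρ g x := by
      refine hρ.mem_range_of_fixed _ fun g => ?_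
      rw [map_sum]
      refine Fintype.sum_equiv (Equiv.mulLeft g) _ _ fun k => ?_
      rw [Equiv.coe_mulLeft, map_mul, AlgEquiv.mul_apply]
    choose t ht using htr
    have hr : r = ∑ i, algebraMap F R (t (r * a i)) * s i := by
      have : ∑ g, ρ g r * ∑ i, ρ g (a i) * ρ 1 (s i) = r := by
        simp_rw [has]
        simp
      refine this.symm.trans ?_
      simp only [ht, Finset.mul_sum, Finset.sum_mul]
      rw [Finset.sum_comm]
      simp [mul_assoc]
    conv_lhs => rw [hr]
    simp only [map_sum, map_mul, hαF]
    simp only [ht, hε, map_sum, map_mul, Finset.mul_sum, Finset.sum_mul]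
    rw [Finset.sum_comm]
    simp [mul_assoc]
  -- On the component of `ε g`, the automorphism `α` acts on `R` as `g`.
  have hmul (g : G) (r : R) : ε g * α (inl r) = inl (ρ g r) * ε g := by
    have : ε g * α (inl r) = ∑ i, inl (ρ g (a i)) * α (inl (s i * r)) := by
      simp only [hε, Finset.sum_mul, map_mul, mul_assoc]
    rw [this]
    simp only [hexp, Finset.mul_sum]
    rw [Finset.sum_comm, Finset.sum_eq_single g]
    · have := congrArg inl (has g g)
      rw [if_pos rfl, map_one, map_sum] at this
      rw [← one_mul (_ * _), ← this, Finset.sum_mul]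
      refine Finset.sum_congr rfl fun i _ => ?_
      rw [map_mul, map_mul inl, map_mul inl]; ring
    · intro k _ hk
      have := congrArg inl (has g k)
      rw [if_neg hk.symm, map_zero, map_sum] at this
      rw [← zero_mul (inl (ρ k r) * ε k), ← this, Finset.sum_mul]
      refine Finset.sum_congr rfl fun i _ => ?_
      rw [map_mul, map_mul inl, map_mul inl]; ring
    · simp
  have hortho (g k : G) (hgk : g ≠ k) : ε g * ε k = 0 := by
    rw [hε k, Finset.mul_sum]
    have := congrArg inl (has k g)
    rw [if_neg hgk.symm, map_zero, map_sum] at this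
    rw [← zero_mul (ε g), ← this, Finset.sum_mul]
    refine Finset.sum_congr rfl fun i _ => ?_
    rw [mul_left_comm, hmul, map_mul, mul_assoc]
  have hsum : ∑ g, ε g = 1 := by
    have := hexp 1
    simpa using this.symm
  -- Differentiating the coordinate relations `∑ᵢ g(aᵢ) g'(sᵢ) = δ_{g,g'}` kills `θ⁽ᵏ⁾(ε g)`.
  have hconst (g : G) (k : ℕ) (hk : k ≠ 0) :
      (θR.tensorTrivial h.algebraMap_constantField D).der k (ε g) = 0 := by
    have h1 (g' : G) : ∑ i, ∑ uv ∈ Finset.HasAntidiagonal.antidiagonal k,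
        ρ g (θR.der uv.1 (a i)) * ρ g' (θR.der uv.2 (s i)) = 0 := by
      have := congrArg (θR.der k) (has g g')
      simp only [map_sum, der_mul, hρ.der_apply] at this
      rw [this]
      split_ifs
      · exact θR.der_one hk
      · exact map_zero _
    have h2 : (θR.tensorTrivial h.algebraMap_constantField D).der k (ε g) =
        ∑ i, ∑ uv ∈ Finset.HasAntidiagonal.antidiagonal k,
          inl (ρ g (θR.der uv.1 (a i))) * α (inl (θR.der uv.2 (s i))) := by
      simp only [hε, map_sum, der_mul, hα.2, hder, hρ.der_apply]
    rw [h2]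
    simp only [hexp, Finset.mul_sum, ← mul_assoc, ← map_mul]
    have h3 : ∀ g', ∑ i, ∑ uv ∈ Finset.HasAntidiagonal.antidiagonal k,
        inl (ρ g (θR.der uv.1 (a i)) * ρ g' (θR.der uv.2 (s i))) * ε g' = 0 := by
      intro g'
      simp only [← Finset.sum_mul, ← map_sum, h1, map_zero, zero_mul]
    trans ∑ g', ∑ i, ∑ uv ∈ Finset.HasAntidiagonal.antidiagonal k,
      inl (ρ g (θR.der uv.1 (a i)) * ρ g' (θR.der uv.2 (s i))) * ε g'
    · conv_rhs => rw [Finset.sum_comm]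
      exact Finset.sum_congr rfl fun i _ => Finset.sum_comm
    · exact Finset.sum_eq_zero fun g' _ => h3 g'
  choose e he using fun g => mem_range_includeRight_of_der_eq_zero θR h.algebraMap_constantField
    hρ.mem_range_of_mem_constants D (hconst g)
  have heC : CompleteOrthogonalIdempotents e := by
    refine CompleteOrthogonalIdempotents.iff_ortho_complete.2 ⟨fun g k hgk => ?_, ?_⟩
    · refine hρ.includeRight_injective (D := D) ?_
      change (1 : R) ⊗ₜ[θ.constantField] (e g * e k) = 1 ⊗ₜ 0
      rw [TensorProduct.tmul_zero, ← hortho g k hgk, ← he, ← he,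
        Algebra.TensorProduct.tmul_mul_tmul, one_mul]
    · refine hρ.includeRight_injective (D := D) ?_
      change (1 : R) ⊗ₜ[θ.constantField] (∑ g, e g) = 1 ⊗ₜ 1
      rw [TensorProduct.tmul_sum]
      simp only [he, hsum]
      rfl
  refine ⟨e, heC, AlgEquiv.ext fun x => ?_⟩
  induction x with
  | zero => simp
  | add x y hx hy => rw [map_add, map_add, hx, hy]
  | tmul r d =>
    have : r ⊗ₜ[θ.constantField] d = inl r * 1 ⊗ₜ d := by simp [hinl]
    rw [twistEquiv_tmul, this, map_mul, hαD, hexp, Finset.sum_mul]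
    refine Finset.sum_congr rfl fun g _ => ?_
    rw [← he, hinl, Algebra.TensorProduct.tmul_mul_tmul, Algebra.TensorProduct.tmul_mul_tmul]
    simp [constAction_apply]

end Torsor

section Torsor

variable {F : Type u} [Field F] {θ : IterativeDerivation F}
  {R : Type v} [CommRing R] [Algebra F R] {θR : IterativeDerivation R}
  {G : Type x} [Group G] [Fintype G] {ρ : G →* (R ≃ₐ[F] R)}

/-- The ID-automorphism of `R ⊗ D` attached to a `D`-point of the constant group scheme of `G`. -/
noncomputable def IsGaloisTorsor.idAutOfPoint (hρ : IsGaloisTorsor θ θR ρ) (h : θR.Extends θ)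
    {D : Type w} [CommRing D] [Algebra θ.constantField D]
    (φ : WithConv (ConstGroupRing θ.constantField G →ₐ[θ.constantField] D)) : idAut h D :=
  ⟨twistEquiv (constAction θ ρ)
    ((ConstGroupRing.completeOrthogonalIdempotents_delta θ.constantField G).map
      φ.ofConv.toRingHom), hρ.twistEquiv_mem_idAut h _⟩

section

variable (hρ : IsGaloisTorsor θ θR ρ) (h : θR.Extends θ) {D : Type w} [CommRing D]
  [Algebra θ.constantField D]

theorem IsGaloisTorsor.idAutOfPoint_tmul
    (φ : WithConv (ConstGroupRing θ.constantField G →ₐ[θ.constantField] D)) (r : R) (d : D) :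
    (hρ.idAutOfPoint h φ).val (r ⊗ₜ d) =
      ∑ g, ρ g r ⊗ₜ[θ.constantField] (φ.ofConv (ConstGroupRing.delta θ.constantField g) * d) :=
  twistEquiv_tmul _ _ _ _

theorem idAut_ext {α β : idAut h D} (H : ∀ (r : R) (d : D),
    α.val (r ⊗ₜ[θ.constantField] d) = β.val (r ⊗ₜ[θ.constantField] d)) : α = β :=
  Subtype.ext (AlgEquiv.toLinearMap_injective (TensorProduct.ext' H))

theorem IsGaloisTorsor.idAutOfPoint_mul
    (φ ψ : WithConv (ConstGroupRing θ.constantField G →ₐ[θ.constantField] D)) :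
    hρ.idAutOfPoint h (φ * ψ) = hρ.idAutOfPoint h φ * hρ.idAutOfPoint h ψ := by
  refine idAut_ext h fun r d => ?_
  have hφ := (ConstGroupRing.completeOrthogonalIdempotents_delta θ.constantField G).map
    φ.ofConv.toRingHom
  have hψ := (ConstGroupRing.completeOrthogonalIdempotents_delta θ.constantField G).map
    ψ.ofConv.toRingHom
  have key : (hρ.idAutOfPoint h φ * hρ.idAutOfPoint h ψ).val (r ⊗ₜ[θ.constantField] d) = _ :=
    twist_twist_tmul (constAction θ ρ) hφ hψ r d
  rw [key, hρ.idAutOfPoint_tmul]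
  simp only [ConstGroupRing.convMul_delta]
  rfl

theorem IsGaloisTorsor.idAutOfPoint_bijective :
    Function.Bijective (hρ.idAutOfPoint h (D := D)) := by
  refine ⟨fun φ ψ hφψ => ?_, fun α => ?_⟩
  · have := hρ.eq_of_twistEquiv_eq _ _ (congrArg Subtype.val hφψ)
    refine WithConv.ext (AlgHom.toLinearMap_injective
      (ConstGroupRing.algHom_eq_of_delta _ fun g => congrFun this g))
  · obtain ⟨e, he, heα⟩ := hρ.exists_twistEquiv_eq h α.2
    refine ⟨WithConv.toConv (ConstGroupRing.ofIdempotents he), idAut_ext h fun r d => ?_⟩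
    rw [hρ.idAutOfPoint_tmul, ← heα, twistEquiv_tmul]
    simp only [ConstGroupRing.ofIdempotents_delta]
    rfl

end

/-- The Galois group scheme of an ID-ring which is a torsor under the finite group `G` is the
constant group scheme of `G`. -/
noncomputable def IsGaloisTorsor.galoisGroupSchemeIso (hρ : IsGaloisTorsor θ θR ρ)
    (h : θR.Extends θ) :
    GaloisGroupSchemeIso.{u, v, w, max u x} h (ConstGroupRing θ.constantField G) where
  equiv D _ _ :=
    { Equiv.ofBijective _ (hρ.idAutOfPoint_bijective h (D := D)) with
      map_mul' := hρ.idAutOfPoint_mul h }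
  natural D D' _ _ _ _ f φ x := by
    change (hρ.idAutOfPoint h _).val _ = Algebra.TensorProduct.map _ f ((hρ.idAutOfPoint h _).val _)
    induction x with
    | zero => simp only [map_zero]
    | add x y hx hy => simp only [map_add, hx, hy]
    | tmul r d =>
      rw [Algebra.TensorProduct.map_tmul, hρ.idAutOfPoint_tmul, hρ.idAutOfPoint_tmul, map_sum]
      simp

theorem IsGaloisTorsor.galoisGroupSchemeIso_tmul (hρ : IsGaloisTorsor θ θR ρ)
    (h : θR.Extends θ) (D : Type w) [CommRing D] [Algebra θ.constantField D]
    (φ : WithConv (ConstGroupRing θ.constantField G →ₐ[θ.constantField] D)) (r : R) (d : D) :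
    ((hρ.galoisGroupSchemeIso h).equiv D φ).val (r ⊗ₜ d) =
      ∑ g, ρ g r ⊗ₜ[θ.constantField] (φ.ofConv (ConstGroupRing.delta θ.constantField g) * d) :=
  hρ.idAutOfPoint_tmul h φ r d

end Torsor

/-! ### Picard-Vessiot rings of finite Galois extensions -/

section Galois

variable {F : Type u} {E : Type v} [Field F] [Field E] [Algebra F E] {θ : IterativeDerivation F}
  {θE : IterativeDerivation E} {R : Type v} [CommRing R] [Algebra F R]

/-- A ring over `F` with quotient field `E` algebraic over `F` is already equal to `E`: the inverse
of an algebraic element is a polynomial in it. -/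
theorem bijective_algebraMap_of_isFractionRing [Algebra.IsAlgebraic F E] [Algebra R E]
    [IsScalarTower F R E] [IsFractionRing R E] : Function.Bijective (algebraMap R E) := by
  refine ⟨IsFractionRing.injective R E, fun x => ?_⟩
  obtain ⟨⟨a, b⟩, hab⟩ := IsLocalization.surj (nonZeroDivisors R) x
  have hinv : (algebraMap R E b)⁻¹ ∈ (IsScalarTower.toAlgHom F R E).range :=
    Subalgebra.inv_mem_of_algebraic (A := (IsScalarTower.toAlgHom F R E).range)
      (x := ⟨algebraMap R E b, b, rfl⟩) (Algebra.IsAlgebraic.isAlgebraic _)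
  obtain ⟨c, hc⟩ := hinv
  refine ⟨a * c, ?_⟩
  have hb : algebraMap R E b ≠ 0 := IsLocalization.map_units E b |>.ne_zero
  change algebraMap R E c = _ at hc
  change x * algebraMap R E b = algebraMap R E a at hab
  rw [map_mul, hc, ← hab, mul_inv_cancel_right₀ hb]

variable [FiniteDimensional F E] [IsGalois F E]

/-- For a finite Galois extension which is geometric over the constants, a ring isomorphic to it
is a torsor under its Galois group. -/
theorem Extends.isGaloisTorsor (h : θE.Extends θ) (hgeo : IsGeometricOver θ.constantField E)
    {θR : IterativeDerivation R} (ι : R ≃ₐ[F] E)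
    (hι : ∀ k r, ι (θR.der k r) = θE.der k (ι r)) :
    IsGaloisTorsor θ θR (AlgEquiv.autCongr ι.symm).toMonoidHom where
  nontrivial := ι.toEquiv.nontrivial
  der_apply σ k r := ι.injective (by
    simp [AlgEquiv.autCongr, hι, h.der_algEquiv])
  mem_range_of_mem_constants r hr := by
    have : ι r ∈ θE.constants := by
      refine θE.mem_constants_iff.2 fun k hk => ?_
      rw [← hι, θR.mem_constants_iff.1 hr k hk, map_zero]
    rw [h.constants_eq hgeo] at this
    obtain ⟨c, hc, hcr⟩ := this
    exact ⟨⟨c, hc⟩, ι.injective ((ι.commutes c).trans hcr)⟩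
  mem_range_of_fixed r hr := by
    obtain ⟨f, hf⟩ := (IsGalois.mem_range_algebraMap_iff_fixed (F := F) (ι r)).2 fun σ => by
      have := congrArg ι (hr σ)
      simpa [AlgEquiv.autCongr] using this
    exact ⟨f, ι.injective ((ι.commutes f).trans hf)⟩
  exists_coordinates := by
    classical
    obtain ⟨n, a, s, has⟩ := exists_galoisCoordinates F E
    refine ⟨n, ι.symm ∘ a, ι.symm ∘ s, fun g g' => ι.injective ?_⟩
    have := has g g'
    simp only [AlgEquiv.autCongr, map_sum, map_mul, Function.comp_apply]
    rw [apply_ite ι, map_one, map_zero]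
    convert this using 2
    simp

end Galois

end IterativeDerivation

theorem mainTheorem4 {F : Type u} {E : Type v} [Field F] [Field E] [Algebra F E]
    [FiniteDimensional F E] [IsGalois F E]
    (p : ℕ) [Fact p.Prime] [CharP F p]
    (θ : IterativeDerivation F) (hθ : θ.IsNondegenerate) [PerfectField θ.constantField]
    (hgeo : IsGeometricOver θ.constantField E) :
    (∃! θE : IterativeDerivation E, θE.Extends θ) ∧
    ∀ θE : IterativeDerivation E, θE.Extends θ →
      θ.IsPVExtension θE ∧
      ∀ (R : Type v) [CommRing R] [Algebra F R] [Algebra R E] [IsScalarTower F R E]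
        (θR : IterativeDerivation R) (hR : θR.Extends θ), θ.HasPVRing θE θR →
        ∃ e : IterativeDerivation.GaloisGroupSchemeIso.{u, v, w, max u v} hR
            (ConstGroupRing θ.constantField (E ≃ₐ[F] E)),
          ∀ (D : Type w) [CommRing D] [Algebra θ.constantField D]
            (σ : E ≃ₐ[F] E) (r : R) (d : D),
            Algebra.TensorProduct.map (IsScalarTower.toAlgHom θ.constantField R E)
                (AlgHom.id θ.constantField D)
                ((e.equiv D (WithConv.toConv ((Algebra.ofId θ.constantField D).comp
                  (ConstGroupRing.eval θ.constantField σ)))).val (r ⊗ₜ[θ.constantField] d)) =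
              σ (algebraMap R E r) ⊗ₜ[θ.constantField] d := by
  classical
  refine ⟨?_, fun θE hE => ⟨hE.isPVExtension hgeo, ?_⟩⟩
  · obtain ⟨θE, hE⟩ := IterativeDerivation.exists_extends_of_isSeparable (E := E) θ
    exact ⟨θE, hE, fun θ' h' => h'.eq_of_isSeparable hE⟩
  · intro R _ _ _ _ θR hR hPV
    have := hPV.isFractionRing
    let ι : R ≃ₐ[F] E := AlgEquiv.ofBijective (IsScalarTower.toAlgHom F R E)
      (IterativeDerivation.bijective_algebraMap_of_isFractionRing (F := F))
    have hι (r : R) : algebraMap R E r = ι r := rfl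
    have hT := hE.isGaloisTorsor hgeo (θR := θR) ι
      fun k r => (hPV.extends_ring.der_algebraMap k r).symm
    refine ⟨hT.galoisGroupSchemeIso hR, fun D _ _ σ r d => ?_⟩
    rw [hT.galoisGroupSchemeIso_tmul, Finset.sum_eq_single σ]
    · simp [ConstGroupRing.eval_delta, hι, AlgEquiv.autCongr]
    · intro g _ hg
      simp [ConstGroupRing.eval_delta, hg.symm]
    · simp
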